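/- Let $p=(p_1,\dots,p_n)$ be a probability vector ($p_i\ge 0$, $\sum_{i} p_i=1$), let $0\le\alpha<\gamma\le 1$, and let $A\in\mathbb{R}^{l\times k}$, $B\in\mathbb{R}^{l\times n}$, $c\in\mathbb{R}^l$ be such that the polyhedron $$\mathcal{X}_T=\{(x,T)\in\mathbb{R}^k\times\mathbb{R}^n : Ax+BT\le c\}$$ is non-empty. Put $\mathcal{W}'=\{w'\in[0,1]^n:\sum_{i=1}^n w'_ip_i=1-\gamma\}$ and, for $T\in\mathbb{R}^n$, $\mathscr{P}(T)=\{(s,\theta)\in\mathbb{R}\times\mathbb{R}^n:\theta_i+sp_i\ge p_iT_i,\ \theta_i\ge 0\ \text{for all } i\}$. Let $\nu^*\in[-\infty,\infty)$ be the optimal value of the bilinear program $$\nu^*=\min_{x,T,s,\theta,w'}\ \frac{1}{\gamma-\alpha}\Bigl((1-\alpha)s+\sum_{i=1}^n\theta_i-\sum_{i=1}^nT_ip_iw'_i\Bigr)\quad\text{s.t. } (s,\theta)\in\mathscr{P}(T),\ w'\in\mathcal{W}',\ (x,T)\in\mathcal{X}_T .$$ Let $\mathrm{R}^*$ be the optimal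 value of its first-level RLT relaxation (R), the linear program in the variables $x,T,s,\theta,w'$ and the linearization variables $T^w_{ij},\theta^w_{ij},s^w_j,x^w_{aj}$ ($i,j\in[n]$, $a\in[k]$), which stand for $T_iw'_j,\ \theta_iw'_j,\ sw'_j,\ x_aw'_j$: $$\mathrm{R}^*=\min\ \frac{1}{\gamma-\alpha}\Bigl((1-\alpha)s+\sum_{i=1}^n(\theta_i-T^w_{ii}p_i)\Bigr)$$ subject to $(s,\theta)\in\mathscr{P}(T)$, $w'\in\mathcal{W}'$, $(x,T)\in\mathcal{X}_T$ and, for all $i,j\in[n]$ and $r\in[l]$, $$\theta^w_{ij}+s^w_jp_i-T^w_{ij}p_i\ge 0,\qquad \theta_i+sp_i-T_ip_i-(\theta^w_{ij}+s^w_jp_i-T^w_{ij}p_i)\ge 0,$$ $$\sum_{j}\bigl(\theta^w_{ij}p_j+s^w_jp_ip_j-T^w_{ij}p_ip_j\bigr)-(1-\gamma)(\theta_i+sp_i-T_ip_i)=0,$$ $$\theta^w_{ij}\ge 0,\qquad \theta_i-\theta^w_{ij}\ge 0,\qquad \sum_j\theta^w_{ij}p_j-(1-\gamma)\theta_i=0,$$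 $$\sum_{a}A_{ra}x^w_{aj}+\sum_iB_{ri}T^w_{ij}-c_rw'_j\le 0,$$ $$\sum_{a}A_{ra}x_a+\sum_iB_{ri}T_i-c_r-\Bigl(\sum_{a}A_{ra}x^w_{aj}+\sum_iB_{ri}T^w_{ij}-c_rw'_j\Bigr)\le 0,$$ $$\sum_{a,j}A_{ra}x^w_{aj}p_j+\sum_{i,j}B_{ri}T^w_{ij}p_j-c_r\sum_jw'_jp_j-(1-\gamma)\Bigl(\sum_{a}A_{ra}x_a+\sum_iB_{ri}T_i-c_r\Bigr)=0 .$$ (Optimal values are infima over the feasible set, equal to $-\infty$ if the objective is unbounded below.) If $1-\gamma<\min_{i\in[n]}p_i$, then $\mathcal{W}'$ is a simplex (the convex hull of finitely many affinely independent points), and the relaxation (R) is exact: $\mathrm{R}^*=\nu^*$. Moreover, a real number is an attained minimum of (R) if and only if it is an attained minimum of the bilinear program. -/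

import Mathlib

/-- The set `W' = {w' ∈ [0,1]^n : ∑ i, w' i * p i = 1 - γ}`. -/
def WPrime {n : ℕ} (p : Fin n → ℝ) (γ : ℝ) : Set (Fin n → ℝ) :=
  {w | (∀ i, 0 ≤ w i ∧ w i ≤ 1) ∧ ∑ i, w i * p i = 1 - γ}

/-- The polyhedron `P(x, T(x))` of pairs `(s, θ)` with `θ i + s p_i ≥ p_i T_i` and `θ i ≥ 0`. -/
def PPoly {n : ℕ} (p T : Fin n → ℝ) : Set (ℝ × (Fin n → ℝ)) :=
  {q | ∀ i, p i * T i ≤ q.2 i + q.1 * p i ∧ 0 ≤ q.2 i}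

/-- The polyhedron `X_T` of pairs `(x, T)` with `A x + B T ≤ c`, row by row. -/
def XT {k n l : ℕ} (A : Matrix (Fin l) (Fin k) ℝ) (B : Matrix (Fin l) (Fin n) ℝ)
    (c : Fin l → ℝ) : Set ((Fin k → ℝ) × (Fin n → ℝ)) :=
  {z | ∀ r, ∑ i, A r i * z.1 i + ∑ i, B r i * z.2 i ≤ c r}

/-- The decision variables `ψ = (x, T(x), s, θ, w')` of the bilinear program. -/
structure Psi (k n : ℕ) where
  x : Fin k → ℝ
  T : Fin n → ℝ
  s : ℝ
  θ : Fin n → ℝ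
  w : Fin n → ℝ

/-- The linearization variables `ζ`: `Tw i j`, `xw a j`, `θw i j`, `sw j` stand for the products
`T i * w' j`, `x a * w' j`, `θ i * w' j`, `s * w' j`. -/
structure Zeta (k n : ℕ) where
  Tw : Fin n → Fin n → ℝ
  xw : Fin k → Fin n → ℝ
  θw : Fin n → Fin n → ℝ
  sw : Fin n → ℝ

/-- The feasible set of the bilinear program. -/
def bilinearFeasible {k n l : ℕ} (p : Fin n → ℝ) (γ : ℝ) (A : Matrix (Fin l) (Fin k) ℝ)
    (B : Matrix (Fin l) (Fin n) ℝ) (c : Fin l → ℝ) : Set (Psi k n) :=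
  {ψ | (ψ.s, ψ.θ) ∈ PPoly p ψ.T ∧ ψ.w ∈ WPrime p γ ∧ (ψ.x, ψ.T) ∈ XT A B c}

/-- The objective of the bilinear program. -/
noncomputable def bilinearObj {k n : ℕ} (p : Fin n → ℝ) (α γ : ℝ) (ψ : Psi k n) : ℝ :=
  1 / (γ - α) * ((1 - α) * ψ.s + ∑ i, ψ.θ i - ∑ i, ψ.T i * p i * ψ.w i)

/-- The linearized product constraints: each constraint defining `P(x, T(x))` and `X_T`, multiplied
by each constraint `w' j ≥ 0`, `1 - w' j ≥ 0`, `∑ j, w' j p_j - (1 - γ) = 0` defining `W'`, with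
every product of two variables replaced by its linearization variable. -/
structure RLTConstraints {k n l : ℕ} (p : Fin n → ℝ) (γ : ℝ) (A : Matrix (Fin l) (Fin k) ℝ)
    (B : Matrix (Fin l) (Fin n) ℝ) (c : Fin l → ℝ) (ψ : Psi k n) (ζ : Zeta k n) : Prop where
  /-- `θ i + s p_i - T_i p_i ≥ 0` times `w' j ≥ 0` -/
  P1_nonneg : ∀ i j, 0 ≤ ζ.θw i j + ζ.sw j * p i - ζ.Tw i j * p i
  /-- `θ i + s p_i - T_i p_i ≥ 0` times `1 - w' j ≥ 0` -/
  P1_le_one : ∀ i j, 0 ≤ ψ.θ i + ψ.s * p i - ψ.T i * p i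
    - (ζ.θw i j + ζ.sw j * p i - ζ.Tw i j * p i)
  /-- `θ i + s p_i - T_i p_i ≥ 0` times `∑ j, w' j p_j - (1 - γ) = 0` -/
  P1_sum : ∀ i, ∑ j, (ζ.θw i j * p j + ζ.sw j * p i * p j - ζ.Tw i j * p i * p j)
    - (1 - γ) * (ψ.θ i + ψ.s * p i - ψ.T i * p i) = 0
  /-- `θ i ≥ 0` times `w' j ≥ 0` -/
  P2_nonneg : ∀ i j, 0 ≤ ζ.θw i j
  /-- `θ i ≥ 0` times `1 - w' j ≥ 0` -/
  P2_le_one : ∀ i j, 0 ≤ ψ.θ i - ζ.θw i j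
  /-- `θ i ≥ 0` times `∑ j, w' j p_j - (1 - γ) = 0` -/
  P2_sum : ∀ i, ∑ j, ζ.θw i j * p j - (1 - γ) * ψ.θ i = 0
  /-- row `r` of `A x + B T - c ≤ 0` times `w' j ≥ 0` -/
  X_nonneg : ∀ r j, ∑ i, A r i * ζ.xw i j + ∑ i, B r i * ζ.Tw i j - c r * ψ.w j ≤ 0
  /-- row `r` of `A x + B T - c ≤ 0` times `1 - w' j ≥ 0` -/
  X_le_one : ∀ r j, ∑ i, A r i * ψ.x i + ∑ i, B r i * ψ.T i - c r
    - (∑ i, A r i * ζ.xw i j + ∑ i, B r i * ζ.Tw i j - c r * ψ.w j) ≤ 0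
  /-- row `r` of `A x + B T - c ≤ 0` times `∑ j, w' j p_j - (1 - γ) = 0` -/
  X_sum : ∀ r, ∑ i, ∑ j, A r i * ζ.xw i j * p j + ∑ i, ∑ j, B r i * ζ.Tw i j * p j
    - c r * ∑ j, ψ.w j * p j
    - (1 - γ) * (∑ i, A r i * ψ.x i + ∑ i, B r i * ψ.T i - c r) = 0

/-- The feasible set of the first-level RLT relaxation (R), in the variables `(ψ, ζ)`. -/
def rltFeasible {k n l : ℕ} (p : Fin n → ℝ) (γ : ℝ) (A : Matrix (Fin l) (Fin k) ℝ)
    (B : Matrix (Fin l) (Fin n) ℝ) (c : Fin l → ℝ) : Set (Psi k n × Zeta k n) :=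
  {q | (q.1.s, q.1.θ) ∈ PPoly p q.1.T ∧ q.1.w ∈ WPrime p γ ∧ (q.1.x, q.1.T) ∈ XT A B c ∧
    RLTConstraints p γ A B c q.1 q.2}

/-- The objective of (R): the products `T i * w' i` are replaced by `Tw i i`. -/
noncomputable def rltObj {k n : ℕ} (p : Fin n → ℝ) (α γ : ℝ) (q : Psi k n × Zeta k n) : ℝ :=
  1 / (γ - α) * ((1 - α) * q.1.s + ∑ i, (q.1.θ i - q.2.Tw i i * p i))

/-- The optimal value `ν*` of the bilinear program (`-∞` if the objective is unbounded below). -/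
noncomputable def nuStar {k n l : ℕ} (p : Fin n → ℝ) (α γ : ℝ) (A : Matrix (Fin l) (Fin k) ℝ)
    (B : Matrix (Fin l) (Fin n) ℝ) (c : Fin l → ℝ) : EReal :=
  ⨅ ψ ∈ bilinearFeasible p γ A B c, (bilinearObj p α γ ψ : EReal)

/-- The optimal value `R*` of (R) (`-∞` if the objective is unbounded below). -/
noncomputable def rltStar {k n l : ℕ} (p : Fin n → ℝ) (α γ : ℝ) (A : Matrix (Fin l) (Fin k) ℝ)
    (B : Matrix (Fin l) (Fin n) ℝ) (c : Fin l → ℝ) : EReal :=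
  ⨅ q ∈ rltFeasible p γ A B c, (rltObj p α γ q : EReal)

/-- A set is a simplex if it is the convex hull of finitely many (at least one) affinely
independent points. -/
def IsSimplex {n : ℕ} (S : Set (Fin n → ℝ)) : Prop :=
  ∃ (m : ℕ) (Δ : Affine.Simplex ℝ (Fin n → ℝ) m), S = convexHull ℝ (Set.range Δ.points)

/-! Products of feasible variables satisfy (R), so `R* ≤ ν*`. Conversely let `γ < 1`. Column `j` of
the linearization variables, divided by `w j`, is feasible for the bilinear program when paired with
vertex `j` of `W'`. The convex weights `p j * w j / (1 - γ)` recombine the objectives of these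
points into the objective of (R), so some column does at least as well. Two gaps are closed by a
lower bound on the bilinear objective. A column with `w j = 0` is a recession direction, hence has
nonnegative cost (`gap_nonneg_of_recession`). The equations of (R) leave a common defect in `s` and
all `T i`. It spans a line in `X_T` along which the objective has slope `γ - α`, so it vanishes
(`eq_zero_of_rowForm_const_eq_zero`). For `γ = 1`, `W' = {0}` and the same arguments kill `Tw` and
`sw`. -/

/-- The scaled coordinate vector `(q / p j) e_j`; for `q = 1 - γ` these are the vertices of `W'`. -/
noncomputable def scaledVertex {n : ℕ} (p : Fin n → ℝ) (q : ℝ) (j : Fin n) : Fin n → ℝ :=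
  Pi.single j (q / p j)

/-! ### The simplex `W'`. -/

/-- The bound `1 - γ < p i` keeps the scaled vertices inside the unit box. -/
theorem scaledVertex_mem_WPrime {n : ℕ} {p : Fin n → ℝ} {γ : ℝ} (hγ : γ ≤ 1)
    (hmin : ∀ i, 1 - γ < p i) (j : Fin n) : scaledVertex p (1 - γ) j ∈ WPrime p γ := by
  have hq : 0 ≤ 1 - γ := by linarith
  have hpos : ∀ i, 0 < p i := fun i => hq.trans_lt (hmin i)
  refine ⟨fun i => ?_, ?_⟩
  · by_cases h : i = j
    · subst h
      simp only [scaledVertex, Pi.single_eq_same]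
      exact ⟨div_nonneg hq (hpos i).le, (div_le_one (hpos i)).2 (hmin i).le⟩
    · simp [scaledVertex, Pi.single_eq_of_ne h]
  · rw [Finset.sum_eq_single j]
    · simp [scaledVertex, (hpos j).ne']
    · intro i _ h
      simp [scaledVertex, Pi.single_eq_of_ne h]
    · simp

theorem convex_WPrime {n : ℕ} (p : Fin n → ℝ) (γ : ℝ) : Convex ℝ (WPrime p γ) := by
  rintro u ⟨hu, hu'⟩ w ⟨hw, hw'⟩ a b ha hb hab
  refine ⟨fun i => ?_, ?_⟩
  · exact convex_Icc (0 : ℝ) 1 (hu i) (hw i) ha hb hab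
  · have : ∑ i, (a • u + b • w) i * p i = a * ∑ i, u i * p i + b * ∑ i, w i * p i := by
      rw [Finset.mul_sum, Finset.mul_sum, ← Finset.sum_add_distrib]
      refine Finset.sum_congr rfl fun i _ => ?_
      simp only [Pi.add_apply, Pi.smul_apply, smul_eq_mul]
      ring
    rw [this, hu', hw', ← add_mul, hab, one_mul]

theorem WPrime_one_eq {n : ℕ} {p : Fin n → ℝ} (hpos : ∀ i, 0 < p i) :
    WPrime p 1 = {0} := by
  ext w
  constructor
  · rintro ⟨hw, hs⟩
    rw [sub_self, Finset.sum_eq_zero_iff_of_nonneg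
      fun i _ => mul_nonneg (hw i).1 (hpos i).le] at hs
    ext i
    exact (mul_eq_zero.1 (hs i (Finset.mem_univ i))).resolve_right (hpos i).ne'
  · rintro rfl
    exact ⟨fun i => by simp, by simp⟩

/-- At `γ = 1` all scaled vertices collapse to `0`; otherwise `w j * p j / (1 - γ)` are barycentric
coordinates. -/
theorem isSimplex_WPrime {n : ℕ} {p : Fin n → ℝ} {γ : ℝ} (hn : n ≠ 0) (hγ : γ ≤ 1)
    (hmin : ∀ i, 1 - γ < p i) : IsSimplex (WPrime p γ) := by
  have hpos : ∀ i, 0 < p i := fun i => by linarith [hmin i]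
  rcases hγ.eq_or_lt with rfl | hlt
  · have : Subsingleton (Fin (0 + 1)) := inferInstanceAs (Subsingleton (Fin 1))
    exact ⟨0, ⟨fun _ => 0, affineIndependent_of_subsingleton ℝ _⟩, by
      simp [WPrime_one_eq hpos]⟩
  have hq : 0 < 1 - γ := by linarith
  obtain ⟨m, rfl⟩ := Nat.exists_eq_succ_of_ne_zero hn
  have hli : AffineIndependent ℝ (scaledVertex p (1 - γ)) := by
    rw [affineIndependent_iff]
    intro S u _ h j hj
    have := congrFun h j
    rw [Finset.sum_apply, Finset.sum_eq_single j] at this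
    · simpa [scaledVertex, hq.ne', (hpos j).ne'] using this
    · intro i _ hij
      simp [scaledVertex, Pi.single_eq_of_ne hij.symm]
    · exact fun h => absurd hj h
  refine ⟨m, ⟨scaledVertex p (1 - γ), hli⟩, Set.Subset.antisymm ?_ ?_⟩
  · rintro w ⟨hw, hs⟩
    have hwc : w = ∑ j, (w j * p j / (1 - γ)) • scaledVertex p (1 - γ) j := by
      ext i
      rw [Finset.sum_apply, Finset.sum_eq_single i]
      · have := (hpos i).ne'
        have := hq.ne'
        simp only [scaledVertex, Pi.smul_apply, Pi.single_eq_same, smul_eq_mul]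
        field_simp
      · intro j _ hij
        simp [scaledVertex, Pi.single_eq_of_ne hij.symm]
      · simp
    rw [hwc]
    refine (convex_convexHull ℝ _).sum_mem
      (fun j _ => div_nonneg (mul_nonneg (hw j).1 (hpos j).le) hq.le) ?_
      (fun j _ => subset_convexHull ℝ _ (Set.mem_range_self j))
    rw [← Finset.sum_div, hs, div_self hq.ne']
  · refine convexHull_min ?_ (convex_WPrime p γ)
    rintro _ ⟨j, rfl⟩
    exact scaledVertex_mem_WPrime hγ hmin j

/-! ### Linear forms for the rows and the objective. -/

/-- The linear form `(x, T) ↦ (A x + B T)_r`. -/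
def rowForm {k n l : ℕ} (A : Matrix (Fin l) (Fin k) ℝ) (B : Matrix (Fin l) (Fin n) ℝ)
    (r : Fin l) : ((Fin k → ℝ) × (Fin n → ℝ)) →ₗ[ℝ] ℝ where
  toFun z := ∑ i, A r i * z.1 i + ∑ i, B r i * z.2 i
  map_add' y z := by
    simp only [Prod.fst_add, Prod.snd_add, Pi.add_apply, mul_add, Finset.sum_add_distrib]
    ring
  map_smul' t z := by
    simp only [Prod.smul_fst, Prod.smul_snd, Pi.smul_apply, smul_eq_mul, RingHom.id_apply,
      mul_add, Finset.mul_sum]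
    congr 1 <;> exact Finset.sum_congr rfl fun i _ => by ring

theorem rowForm_apply {k n l : ℕ} (A : Matrix (Fin l) (Fin k) ℝ) (B : Matrix (Fin l) (Fin n) ℝ)
    (r : Fin l) (x : Fin k → ℝ) (T : Fin n → ℝ) :
    rowForm A B r (x, T) = ∑ i, A r i * x i + ∑ i, B r i * T i := rfl

/-- The bilinear objective without the factor `1 / (γ - α)`. -/
def gap {n : ℕ} (p : Fin n → ℝ) (α : ℝ) (T : Fin n → ℝ) (s : ℝ) (θ w : Fin n → ℝ) : ℝ :=
  (1 - α) * s + ∑ i, θ i - ∑ i, T i * p i * w i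

theorem gap_add_smul {n : ℕ} (p : Fin n → ℝ) (α : ℝ) (T dT : Fin n → ℝ) (s ds : ℝ)
    (θ dθ w : Fin n → ℝ) (t : ℝ) :
    gap p α (T + t • dT) (s + t * ds) (θ + t • dθ) w
      = gap p α T s θ w + t * gap p α dT ds dθ w := by
  simp only [gap, Pi.add_apply, Pi.smul_apply, smul_eq_mul, add_mul, Finset.sum_add_distrib,
    mul_add, mul_sub, Finset.mul_sum, mul_assoc]
  ring

theorem gap_smul {n : ℕ} (p : Fin n → ℝ) (α : ℝ) (T : Fin n → ℝ) (s : ℝ) (θ w : Fin n → ℝ)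
    (t : ℝ) : gap p α (t • T) (t * s) (t • θ) w = t * gap p α T s θ w := by
  simpa [gap] using gap_add_smul p α 0 T 0 s 0 θ w t

/-- Only `T j` survives at vertex `j`, which is why the diagonal entries `Tw j j` appear on
recombining columns. -/
theorem gap_scaledVertex {n : ℕ} {p : Fin n → ℝ} (α q : ℝ) (T : Fin n → ℝ) (s : ℝ)
    (θ : Fin n → ℝ) {j : Fin n} (hj : p j ≠ 0) :
    gap p α T s θ (scaledVertex p q j) = (1 - α) * s + ∑ i, θ i - q * T j := by
  have h : ∑ i, T i * p i * scaledVertex p q j i = q * T j := by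
    rw [Finset.sum_eq_single j]
    · simp only [scaledVertex, Pi.single_eq_same]
      field_simp
    · intro i _ h
      simp [scaledVertex, Pi.single_eq_of_ne h]
    · simp
  rw [gap, h]

/-! ### Recession directions of a bounded bilinear program. -/

section Bilinear

variable {k n l : ℕ} {p : Fin n → ℝ} {α γ : ℝ} {A : Matrix (Fin l) (Fin k) ℝ}
  {B : Matrix (Fin l) (Fin n) ℝ} {c : Fin l → ℝ}

theorem exists_mem_bilinearFeasible (hp : ∀ i, 0 ≤ p i) (hX : (XT A B c).Nonempty)
    {w : Fin n → ℝ} (hw : w ∈ WPrime p γ) : ∃ ψ ∈ bilinearFeasible p γ A B c, ψ.w = w := by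
  obtain ⟨⟨x, T⟩, hxT⟩ := hX
  -- Any `s` above every `T i` allows `θ = 0`.
  refine ⟨⟨x, T, ∑ i, |T i|, 0, w⟩, ⟨fun i => ⟨?_, le_rfl⟩, hw, hxT⟩, rfl⟩
  have h : T i ≤ ∑ i, |T i| := (le_abs_self _).trans
    (Finset.single_le_sum (f := fun i => |T i|) (fun i _ => abs_nonneg _) (Finset.mem_univ i))
  have := mul_le_mul_of_nonneg_left h (hp i)
  simp only [Pi.zero_apply]
  linarith

/-- A bilinear objective that is bounded below is nonnegative on recession directions. -/
theorem gap_nonneg_of_recession {v : ℝ} (hp : ∀ i, 0 ≤ p i) (hαγ : α < γ)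
    (hX : (XT A B c).Nonempty) (hv : ∀ ψ ∈ bilinearFeasible p γ A B c, v ≤ bilinearObj p α γ ψ)
    {w : Fin n → ℝ} (hw : w ∈ WPrime p γ) {dx : Fin k → ℝ} {dT : Fin n → ℝ} {ds : ℝ}
    {dθ : Fin n → ℝ} (hP : ∀ i, p i * dT i ≤ dθ i + ds * p i) (hθ : ∀ i, 0 ≤ dθ i)
    (hr : ∀ r, rowForm A B r (dx, dT) ≤ 0) : 0 ≤ gap p α dT ds dθ w := by
  obtain ⟨⟨x, T, s, θ, w'⟩, ⟨hψP, hψw, hψX⟩, rfl⟩ := exists_mem_bilinearFeasible hp hX hw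
  have hd : 0 < γ - α := sub_pos.2 hαγ
  have key : ∀ t, 0 ≤ t → v * (γ - α) ≤ gap p α T s θ w' + t * gap p α dT ds dθ w' := by
    intro t ht
    rw [← gap_add_smul]
    have hmem : (⟨x + t • dx, T + t • dT, s + t * ds, θ + t • dθ, w'⟩ : Psi k n) ∈
        bilinearFeasible p γ A B c := by
      refine ⟨fun i => ⟨?_, ?_⟩, hψw, fun r => ?_⟩
      · have h1 := (hψP i).1
        have h2 := mul_le_mul_of_nonneg_left (hP i) ht
        simp only [Pi.add_apply, Pi.smul_apply, smul_eq_mul] at h1 ⊢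
        linarith
      · exact add_nonneg (hψP i).2 (mul_nonneg ht (hθ i))
      · change rowForm A B r ((x, T) + t • (dx, dT)) ≤ c r
        rw [map_add, map_smul, smul_eq_mul]
        have h1 : rowForm A B r (x, T) ≤ c r := hψX r
        have h2 := mul_nonpos_of_nonneg_of_nonpos ht (hr r)
        linarith
    have h := hv _ hmem
    rw [bilinearObj, one_div_mul_eq_div, le_div_iff₀ hd] at h
    exact h
  by_contra! hG
  have h0 := key 0 le_rfl
  -- This `t` would bring the objective to exactly `1` below the bound; `h0` makes it nonnegative.
  have h1 := key ((gap p α T s θ w' - v * (γ - α) + 1) / -gap p α dT ds dθ w')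
    (div_nonneg (by linarith) (by linarith))
  have h2 : (gap p α T s θ w' - v * (γ - α) + 1) / -gap p α dT ds dθ w' * gap p α dT ds dθ w'
      = -(gap p α T s θ w' - v * (γ - α) + 1) := by
    have := hG.ne
    field_simp
  rw [h2] at h1
  linarith

/-- If the bilinear objective is bounded below, the lineality space of `X_T` contains no direction
whose `T`-part is a nonzero constant vector. -/
theorem eq_zero_of_rowForm_const_eq_zero {v : ℝ} (hp : ∀ i, 0 ≤ p i) (hαγ : α < γ)
    (hX : (XT A B c).Nonempty) (hv : ∀ ψ ∈ bilinearFeasible p γ A B c, v ≤ bilinearObj p α γ ψ)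
    (hW : (WPrime p γ).Nonempty) {dx : Fin k → ℝ} {δ : ℝ}
    (hr : ∀ r, rowForm A B r (dx, fun _ => δ) = 0) : δ = 0 := by
  obtain ⟨w, hw⟩ := hW
  have hgap : ∀ ε, gap p α (fun _ => ε) ε 0 w = (γ - α) * ε := by
    intro ε
    have : ∑ i, ε * p i * w i = ε * (1 - γ) := by
      rw [← hw.2, Finset.mul_sum]
      exact Finset.sum_congr rfl fun i _ => by ring
    simp only [gap, Pi.zero_apply, Finset.sum_const_zero, this]
    ring
  have hd : 0 < γ - α := sub_pos.2 hαγ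
  -- Taking `ds = δ` and `dθ = 0` makes the constraints of `P` tight, so both signs of the direction
  -- are admissible.
  have h1 := gap_nonneg_of_recession hp hαγ hX hv hw (dx := dx) (dT := fun _ => δ) (ds := δ)
    (dθ := 0) (fun i => by simp [mul_comm]) (fun i => le_rfl) (fun r => (hr r).le)
  have h2 := gap_nonneg_of_recession hp hαγ hX hv hw (dx := -dx) (dT := fun _ => -δ) (ds := -δ)
    (dθ := 0) (fun i => by simp [mul_comm]) (fun i => le_rfl) (fun r => by
      have := map_neg (rowForm A B r) (dx, fun _ => δ)
      rw [hr, neg_zero] at this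
      exact this.le)
  rw [hgap] at h1 h2
  nlinarith

/-! ### Lifting to (R). -/

/-- Every feasible point of the bilinear program lifts to (R) with the same objective value. -/
theorem exists_rltFeasible_of_bilinearFeasible {ψ : Psi k n}
    (hψ : ψ ∈ bilinearFeasible p γ A B c) :
    ∃ ζ, (ψ, ζ) ∈ rltFeasible p γ A B c ∧ rltObj p α γ (ψ, ζ) = bilinearObj p α γ ψ := by
  obtain ⟨hP, hw, hX⟩ := hψ
  have hP1 : ∀ i, 0 ≤ ψ.θ i + ψ.s * p i - ψ.T i * p i := fun i => by
    have := (hP i).1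
    simp only at this
    linarith
  have hrow : ∀ r j, ∑ i, A r i * (ψ.x i * ψ.w j) + ∑ i, B r i * (ψ.T i * ψ.w j)
      = (∑ i, A r i * ψ.x i + ∑ i, B r i * ψ.T i) * ψ.w j := fun r j => by
    simp only [add_mul, Finset.sum_mul, mul_assoc]
  refine ⟨⟨fun i j => ψ.T i * ψ.w j, fun a j => ψ.x a * ψ.w j, fun i j => ψ.θ i * ψ.w j,
    fun j => ψ.s * ψ.w j⟩, ⟨hP, hw, hX, ?_⟩, ?_⟩
  · constructor
    · intro i j
      have := mul_nonneg (hP1 i) (hw.1 j).1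
      dsimp only
      linarith
    · intro i j
      have := mul_nonneg (hP1 i) (sub_nonneg.2 (hw.1 j).2)
      dsimp only
      linarith
    · intro i
      rw [← hw.2, Finset.sum_mul, ← Finset.sum_sub_distrib]
      exact Finset.sum_eq_zero fun j _ => by ring
    · exact fun i j => mul_nonneg (hP i).2 (hw.1 j).1
    · intro i j
      have := mul_nonneg (hP i).2 (sub_nonneg.2 (hw.1 j).2)
      dsimp only at this ⊢
      linarith
    · intro i
      rw [← hw.2, Finset.sum_mul, ← Finset.sum_sub_distrib]
      exact Finset.sum_eq_zero fun j _ => by ring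
    · intro r j
      have := mul_nonneg (sub_nonneg.2 (hX r)) (hw.1 j).1
      dsimp only at this ⊢
      rw [hrow]
      linarith
    · intro r j
      have := mul_nonneg (sub_nonneg.2 (hX r)) (sub_nonneg.2 (hw.1 j).2)
      dsimp only at this ⊢
      rw [hrow]
      linarith
    · intro r
      have h1 : ∑ i, ∑ j, A r i * (ψ.x i * ψ.w j) * p j
          = (1 - γ) * ∑ i, A r i * ψ.x i := by
        rw [← hw.2, Finset.sum_mul_sum, Finset.sum_comm]
        exact Finset.sum_congr rfl fun i _ => Finset.sum_congr rfl fun j _ => by ring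
      have h2 : ∑ i, ∑ j, B r i * (ψ.T i * ψ.w j) * p j
          = (1 - γ) * ∑ i, B r i * ψ.T i := by
        rw [← hw.2, Finset.sum_mul_sum, Finset.sum_comm]
        exact Finset.sum_congr rfl fun i _ => Finset.sum_congr rfl fun j _ => by ring
      dsimp only
      rw [h1, h2, hw.2]
      ring
  · simp only [rltObj, bilinearObj]
    rw [Finset.sum_sub_distrib, add_sub_assoc]
    congr 3
    exact Finset.sum_congr rfl fun i _ => by ring

/-! ### From (R) back to the bilinear program. -/

/-- The row constraints of (R) multiplied by the equation of `W'`, as a value of the row form. -/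
theorem rowForm_sum_sub_eq_zero {ψ : Psi k n} {ζ : Zeta k n}
    (hw : ψ.w ∈ WPrime p γ) (h : RLTConstraints p γ A B c ψ ζ) (r : Fin l) :
    rowForm A B r (fun a => ∑ j, ζ.xw a j * p j - (1 - γ) * ψ.x a,
      fun i => ∑ j, ζ.Tw i j * p j - (1 - γ) * ψ.T i) = 0 := by
  have h0 := h.X_sum r
  rw [hw.2] at h0
  simp only [rowForm_apply, mul_sub, Finset.sum_sub_distrib, Finset.mul_sum] at h0 ⊢
  simp only [mul_add, Finset.mul_sum] at h0
  simp only [← mul_assoc, mul_comm _ (1 - γ)] at h0 ⊢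
  linarith

/-- The constraints of (R) from `P(x, T(x))`, multiplied by the equation of `W'`, tie the defects
of `T` and `s` together. -/
theorem sum_Tw_sub_eq_sum_sw_sub (hpos : ∀ i, 0 < p i) {ψ : Psi k n} {ζ : Zeta k n}
    (h : RLTConstraints p γ A B c ψ ζ) (i : Fin n) :
    ∑ j, ζ.Tw i j * p j - (1 - γ) * ψ.T i = ∑ j, ζ.sw j * p j - (1 - γ) * ψ.s := by
  have h1 := h.P1_sum i
  have h2 := h.P2_sum i
  have h3 : ∑ j, (ζ.θw i j * p j + ζ.sw j * p i * p j - ζ.Tw i j * p i * p j)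
      = ∑ j, ζ.θw i j * p j + p i * ∑ j, ζ.sw j * p j - p i * ∑ j, ζ.Tw i j * p j := by
    rw [Finset.sum_sub_distrib, Finset.sum_add_distrib, Finset.mul_sum, Finset.mul_sum]
    congr 1
    · congr 1
      exact Finset.sum_congr rfl fun j _ => by ring
    · exact Finset.sum_congr rfl fun j _ => by ring
  refine mul_left_cancel₀ (hpos i).ne' ?_
  rw [h3] at h1
  linarith

/-- If the bilinear objective is bounded below, the bilinear program does at least as well as any
feasible point of (R): the case of a nondegenerate simplex `W'`. -/
theorem exists_bilinearObj_le_rltObj_of_lt_one {v : ℝ} (hαγ : α < γ) (hγ : γ < 1)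
    (hmin : ∀ i, 1 - γ < p i) (hX : (XT A B c).Nonempty)
    (hv : ∀ ψ ∈ bilinearFeasible p γ A B c, v ≤ bilinearObj p α γ ψ)
    {q : Psi k n × Zeta k n} (hq : q ∈ rltFeasible p γ A B c) :
    ∃ ψ ∈ bilinearFeasible p γ A B c, bilinearObj p α γ ψ ≤ rltObj p α γ q := by
  obtain ⟨ψ, ζ⟩ := q
  obtain ⟨-, hw, -, hR⟩ := hq
  dsimp only at hw hR
  have hm : 0 < 1 - γ := sub_pos.2 hγ
  have hpos : ∀ i, 0 < p i := fun i => hm.trans (hmin i)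
  have hd : 0 < γ - α := sub_pos.2 hαγ
  have hvert := scaledVertex_mem_WPrime hγ.le hmin
  have hδ : ∑ j, ζ.sw j * p j - (1 - γ) * ψ.s = 0 := by
    refine eq_zero_of_rowForm_const_eq_zero (fun i => (hpos i).le) hαγ hX hv ⟨_, hw⟩
      (dx := fun a => ∑ j, ζ.xw a j * p j - (1 - γ) * ψ.x a) fun r => ?_
    rw [← rowForm_sum_sub_eq_zero hw hR r]
    congr 2
    ext i
    exact (sum_Tw_sub_eq_sum_sw_sub hpos hR i).symm
  set N := (1 - α) * ψ.s + ∑ i, (ψ.θ i - ζ.Tw i i * p i) with hN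
  -- Cost of the undivided column `j` at vertex `j`.
  let F : Fin n → ℝ := fun j =>
    gap p α (fun i => ζ.Tw i j) (ζ.sw j) (fun i => ζ.θw i j) (scaledVertex p (1 - γ) j)
  have hP : ∀ i j, p i * ζ.Tw i j ≤ ζ.θw i j + ζ.sw j * p i := fun i j => by
    linarith [hR.P1_nonneg i j]
  have hrow : ∀ r j, rowForm A B r (fun a => ζ.xw a j, fun i => ζ.Tw i j) ≤ c r * ψ.w j :=
    fun r j => by
      rw [rowForm_apply]
      linarith [hR.X_nonneg r j]
  have hF : ∑ j, p j * F j = (1 - γ) * N := by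
    have hθ : ∑ j, p j * ∑ i, ζ.θw i j = (1 - γ) * ∑ i, ψ.θ i := by
      simp only [Finset.mul_sum]
      rw [Finset.sum_comm]
      refine Finset.sum_congr rfl fun i _ => ?_
      rw [← sub_eq_zero, ← hR.P2_sum i]
      congr 1
      exact Finset.sum_congr rfl fun j _ => mul_comm _ _
    have hF' : ∀ j, p j * F j = (1 - α) * (ζ.sw j * p j) + p j * ∑ i, ζ.θw i j
        - (1 - γ) * (ζ.Tw j j * p j) := fun j => by
      simp only [F, gap_scaledVertex _ _ _ _ _ (hpos j).ne']
      ring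
    simp only [hF', Finset.sum_sub_distrib, Finset.sum_add_distrib, ← Finset.mul_sum, hθ, hN]
    linear_combination (1 - α) * hδ
  by_contra! hcon
  have hlt : ∀ j, 0 < ψ.w j → ψ.w j * N < F j := by
    intro j hj
    have hj' : 0 < (ψ.w j)⁻¹ := inv_pos.2 hj
    have hmem : (⟨(ψ.w j)⁻¹ • fun a => ζ.xw a j, (ψ.w j)⁻¹ • fun i => ζ.Tw i j,
        (ψ.w j)⁻¹ * ζ.sw j, (ψ.w j)⁻¹ • fun i => ζ.θw i j,
        scaledVertex p (1 - γ) j⟩ : Psi k n) ∈ bilinearFeasible p γ A B c := by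
      refine ⟨fun i => ⟨?_, mul_nonneg hj'.le (hR.P2_nonneg i j)⟩, hvert j, fun r => ?_⟩
      · have := mul_le_mul_of_nonneg_left (hP i j) hj'.le
        simp only [Pi.smul_apply, smul_eq_mul]
        linarith
      · change rowForm A B r ((ψ.w j)⁻¹ • (fun a => ζ.xw a j, fun i => ζ.Tw i j)) ≤ c r
        rw [map_smul, smul_eq_mul, inv_mul_le_iff₀ hj, mul_comm]
        exact hrow r j
    have h := hcon _ hmem
    have hobj : N < (ψ.w j)⁻¹ * F j := by
      rw [← gap_smul]
      exact lt_of_mul_lt_mul_left h (one_div_pos.2 hd).le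
    rwa [lt_inv_mul_iff₀ hj] at hobj
  have hle : ∀ j, ψ.w j * N ≤ F j := by
    intro j
    rcases (hw.1 j).1.eq_or_lt with h | h
    · rw [← h, zero_mul]
      exact gap_nonneg_of_recession (fun i => (hpos i).le) hαγ hX hv (hvert j)
        (dx := fun a => ζ.xw a j) (fun i => hP i j) (fun i => hR.P2_nonneg i j)
        (fun r => (hrow r j).trans_eq (by rw [← h, mul_zero]))
    · exact (hlt j h).le
  -- One strict inequality suffices for the contradiction, and `∑ w j * p j = 1 - γ > 0` supplies
  -- it.
  obtain ⟨j, hj⟩ : ∃ j, 0 < ψ.w j := by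
    by_contra! h
    have := Finset.sum_nonpos fun j (_ : j ∈ Finset.univ) =>
      mul_nonpos_of_nonpos_of_nonneg (h j) (hpos j).le
    rw [hw.2] at this
    linarith
  have hsum : ∑ j, p j * (ψ.w j * N) < ∑ j, p j * F j :=
    Finset.sum_lt_sum (fun j _ => mul_le_mul_of_nonneg_left (hle j) (hpos j).le)
      ⟨j, Finset.mem_univ j, mul_lt_mul_of_pos_left (hlt j hj) (hpos j)⟩
  have heq : ∑ j, p j * (ψ.w j * N) = (1 - γ) * N := by
    rw [← hw.2, Finset.sum_mul]
    exact Finset.sum_congr rfl fun j _ => by ring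
  rw [hF, heq] at hsum
  exact lt_irrefl _ hsum

/-- If the bilinear objective is bounded below, the bilinear program does at least as well as any
feasible point of (R): the case where `W'` is a single point. -/
theorem exists_bilinearObj_le_rltObj_of_eq_one {v : ℝ} (hα : α < 1) (hpos : ∀ i, 0 < p i)
    (hX : (XT A B c).Nonempty)
    (hv : ∀ ψ ∈ bilinearFeasible p 1 A B c, v ≤ bilinearObj p α 1 ψ)
    {q : Psi k n × Zeta k n} (hq : q ∈ rltFeasible p 1 A B c) :
    ∃ ψ ∈ bilinearFeasible p 1 A B c, bilinearObj p α 1 ψ ≤ rltObj p α 1 q := by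
  obtain ⟨ψ, ζ⟩ := q
  obtain ⟨hPψ, hw, hXψ, hR⟩ := hq
  dsimp only at hPψ hw hXψ hR
  have hw0 : ψ.w = 0 := by
    simpa [WPrime_one_eq hpos] using hw
  refine ⟨ψ, ⟨hPψ, hw, hXψ⟩, le_of_eq ?_⟩
  -- With `1 - γ = 0`, each product with the equation of `W'` says that a positively weighted sum of
  -- terms of one sign vanishes, so every term does.
  have hθ : ∀ i j, ζ.θw i j = 0 := by
    intro i j
    have h := hR.P2_sum i
    rw [sub_self, zero_mul, sub_zero, Finset.sum_eq_zero_iff_of_nonneg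
      fun j _ => mul_nonneg (hR.P2_nonneg i j) (hpos j).le] at h
    exact (mul_eq_zero.1 (h j (Finset.mem_univ j))).resolve_right (hpos j).ne'
  have hTw : ∀ i j, ζ.Tw i j = ζ.sw j := by
    intro i j
    have h : ∑ j, (ζ.θw i j + ζ.sw j * p i - ζ.Tw i j * p i) * p j = 0 := by
      rw [← hR.P1_sum i, sub_self, zero_mul, sub_zero]
      exact Finset.sum_congr rfl fun j _ => by ring
    rw [Finset.sum_eq_zero_iff_of_nonneg
      fun j _ => mul_nonneg (hR.P1_nonneg i j) (hpos j).le] at h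
    have := (mul_eq_zero.1 (h j (Finset.mem_univ j))).resolve_right (hpos j).ne'
    rw [hθ] at this
    exact mul_right_cancel₀ (hpos i).ne' (by linarith)
  have hrow : ∀ j r, rowForm A B r (fun a => ζ.xw a j, fun i => ζ.Tw i j) = 0 := by
    intro j r
    have hnonpos : ∀ j, rowForm A B r (fun a => ζ.xw a j, fun i => ζ.Tw i j) ≤ 0 := fun j => by
      have := hR.X_nonneg r j
      rwa [hw0, Pi.zero_apply, mul_zero, sub_zero] at this
    have h : ∑ j, rowForm A B r (fun a => ζ.xw a j, fun i => ζ.Tw i j) * p j = 0 := by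
      have h0 := hR.X_sum r
      rw [hw.2, sub_self, mul_zero, zero_mul, sub_zero, sub_zero] at h0
      rw [← h0, Finset.sum_comm, Finset.sum_comm (f := fun i j => B r i * ζ.Tw i j * p j),
        ← Finset.sum_add_distrib]
      exact Finset.sum_congr rfl fun j _ => by
        rw [rowForm_apply, add_mul, Finset.sum_mul, Finset.sum_mul]
    rw [Finset.sum_eq_zero_iff_of_nonpos
      fun j _ => mul_nonpos_of_nonpos_of_nonneg (hnonpos j) (hpos j).le] at h
    exact (mul_eq_zero.1 (h j (Finset.mem_univ j))).resolve_right (hpos j).ne'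
  have hsw : ∀ j, ζ.sw j = 0 := fun j =>
    eq_zero_of_rowForm_const_eq_zero (fun i => (hpos i).le) hα hX hv ⟨_, hw⟩
      (dx := fun a => ζ.xw a j) fun r => by
        simpa only [hTw] using hrow j r
  simp [bilinearObj, rltObj, hTw, hsw, hw0]

theorem exists_bilinearObj_le_rltObj {v : ℝ} (hαγ : α < γ) (hγ : γ ≤ 1)
    (hmin : ∀ i, 1 - γ < p i) (hX : (XT A B c).Nonempty)
    (hv : ∀ ψ ∈ bilinearFeasible p γ A B c, v ≤ bilinearObj p α γ ψ)
    {q : Psi k n × Zeta k n} (hq : q ∈ rltFeasible p γ A B c) :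
    ∃ ψ ∈ bilinearFeasible p γ A B c, bilinearObj p α γ ψ ≤ rltObj p α γ q := by
  rcases hγ.eq_or_lt with rfl | hlt
  · exact exists_bilinearObj_le_rltObj_of_eq_one hαγ (fun i => by simpa using hmin i) hX hv hq
  · exact exists_bilinearObj_le_rltObj_of_lt_one hαγ hlt hmin hX hv hq

end Bilinear

/-! ### Exactness and attainment. -/

theorem mainTheorem9 {k n l : ℕ} (p : Fin n → ℝ) (hp : ∀ i, 0 ≤ p i) (hp1 : ∑ i, p i = 1)
    (α γ : ℝ) (hα : 0 ≤ α) (hαγ : α < γ) (hγ : γ ≤ 1)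
    (A : Matrix (Fin l) (Fin k) ℝ) (B : Matrix (Fin l) (Fin n) ℝ) (c : Fin l → ℝ)
    (hX : (XT A B c).Nonempty)
    (hmin : 1 - γ < ⨅ i, p i) :
    IsSimplex (WPrime p γ) ∧
      rltStar p α γ A B c = nuStar p α γ A B c ∧
      (∀ v : ℝ, IsLeast (rltObj p α γ '' rltFeasible p γ A B c) v ↔
        IsLeast (bilinearObj p α γ '' bilinearFeasible p γ A B c) v) := by
  have hn : n ≠ 0 := by
    rintro rfl
    simp at hp1
  have hmin' : ∀ i, 1 - γ < p i := fun i =>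
    hmin.trans_le (ciInf_le (Set.finite_range p).bddBelow i)
  refine ⟨isSimplex_WPrime hn hγ hmin', le_antisymm ?_ ?_, fun v => ⟨?_, ?_⟩⟩
  · refine le_iInf₂ fun ψ hψ => ?_
    obtain ⟨ζ, hζ, hobj⟩ := exists_rltFeasible_of_bilinearFeasible (α := α) hψ
    rw [← hobj]
    exact iInf₂_le (ψ, ζ) hζ
  · refine le_iInf₂ fun q hq => ?_
    by_contra! hlt
    -- A point of (R) beating `ν*` itself provides the lower bound, so the unbounded case needs no
    -- separate treatment.
    have hv : ∀ ψ ∈ bilinearFeasible p γ A B c, rltObj p α γ q ≤ bilinearObj p α γ ψ :=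
      fun ψ hψ => EReal.coe_le_coe_iff.1 (hlt.le.trans (iInf₂_le ψ hψ))
    obtain ⟨ψ, hψ, hle⟩ := exists_bilinearObj_le_rltObj hαγ hγ hmin' hX hv hq
    exact (hlt.trans_le (iInf₂_le ψ hψ)).not_ge (EReal.coe_le_coe_iff.2 hle)
  · rintro ⟨⟨q, hq, rfl⟩, hlow⟩
    have hv : ∀ ψ ∈ bilinearFeasible p γ A B c, rltObj p α γ q ≤ bilinearObj p α γ ψ := by
      intro ψ hψ
      obtain ⟨ζ, hζ, hobj⟩ := exists_rltFeasible_of_bilinearFeasible (α := α) hψ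
      exact hobj ▸ hlow ⟨_, hζ, rfl⟩
    obtain ⟨ψ, hψ, hle⟩ := exists_bilinearObj_le_rltObj hαγ hγ hmin' hX hv hq
    refine ⟨⟨ψ, hψ, le_antisymm hle (hv ψ hψ)⟩, ?_⟩
    rintro _ ⟨ψ', hψ', rfl⟩
    exact hv ψ' hψ'
  · rintro ⟨⟨ψ, hψ, rfl⟩, hlow⟩
    obtain ⟨ζ, hζ, hobj⟩ := exists_rltFeasible_of_bilinearFeasible (α := α) hψ
    refine ⟨⟨_, hζ, hobj⟩, ?_⟩
    rintro _ ⟨q, hq, rfl⟩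
    obtain ⟨ψ', hψ', hle⟩ := exists_bilinearObj_le_rltObj hαγ hγ hmin' hX
      (fun ψ' hψ' => hlow ⟨ψ', hψ', rfl⟩) hq
    exact (hlow ⟨ψ', hψ', rfl⟩).trans hle
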